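/- A \emph{graph model} $\mathcal{G}$ is given by its web, a pair $(G,i)$ consisting of a non-empty (hence infinite) set $G$ and an injective total function $i : G^*\times G\to G$, where $G^*$ is the set of finite subsets of $G$. Given an environment $\rho:\mathrm{Var}\to\mathcal{P}(G)$, where $\mathrm{Var}$ is the countably infinite set of variables, $\lambda$-terms are interpreted in $\mathcal{P}(G)$ by $$[\![x]\!]_\rho=\rho(x),\qquad [\![MN]\!]_\rho=\{\alpha\in G : \exists a\in G^*,\ a\subseteq[\![N]\!]_\rho,\ i(a,\alpha)\in[\![M]\!]_\rho\},$$ $$[\![\lambda x.M]\!]_\rho=\{i(a,\alpha) : a\in G^*,\ \alpha\in[\![M]\!]_{\rho[x:=a]}\}.$$ The \emph{order theory} (resp. \emph{equational theory}) of $\mathcal{G}$ is the set of all pairs $(M,N)$ of $\lambda$-terms such that $[\![M]\!]_\rho\subseteq[\![N]\!]_\rho$ (resp. $[\![M]\!]_\rho=[\![N]\!]_\rho$) for all environments $\rho$. \textbf{Theorem.} For every graph model $\mathcal{G}$ there is a graph model $\mathcal{G}'$ which has a countable web and the same order theory as $\mathcal{G}$, and hence also the same equational theory as $\mathcal{G}$.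 -/

import Mathlib

/-- Raw λ-terms over the countable set of variables `ℕ`. -/
inductive LambdaTerm : Type where
  | var : ℕ → LambdaTerm
  | app : LambdaTerm → LambdaTerm → LambdaTerm
  | lam : ℕ → LambdaTerm → LambdaTerm

universe u

/-- A graph model, given by its web: a nonempty set `Web` with an injection
`code : Web^* × Web → Web`, where `Web^*` is the set of finite subsets of `Web`. The underlying
domain of the model is the powerset `Set Web`, ordered by inclusion.
Such a web is automatically infinite, see `GraphModel.infinite_web`. -/
structure GraphModel where
  Web : Type u
  nonempty : Nonempty Web
  code : Finset Web × Web → Web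
  code_injective : Function.Injective code

namespace GraphModel

theorem infinite_web (G : GraphModel.{u}) : Infinite G.Web := by
  obtain ⟨x⟩ := G.nonempty
  refine not_finite_iff_infinite.mp fun hfin => ?_
  have h : Function.Injective fun X : Set G.Web => G.code (X.toFinite.toFinset, x) := by
    intro X Y hXY
    have := G.code_injective hXY
    simpa using this
  exact Function.cantor_injective _ h

variable (G : GraphModel.{u})

/-- Application on the domain `Set G.Web`. -/
def app (X Y : Set G.Web) : Set G.Web :=
  {α | ∃ a : Finset G.Web, (a : Set G.Web) ⊆ Y ∧ G.code (a, α) ∈ X}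

/-- The trace of a function on the domain: the element of the domain that represents it
(if it is Scott continuous). -/
def abs (f : Set G.Web → Set G.Web) : Set G.Web :=
  {γ | ∃ (a : Finset G.Web) (α : G.Web), α ∈ f (a : Set G.Web) ∧ γ = G.code (a, α)}

/-- Interpretation of a λ-term in the graph model under an environment `ρ`. -/
def interp : LambdaTerm → (ℕ → Set G.Web) → Set G.Web
  | .var x, ρ => ρ x
  | .app M N, ρ => G.app (interp M ρ) (interp N ρ)
  | .lam x M, ρ => G.abs fun X => interp M (Function.update ρ x X)

/-- The order theory of `G`: all pairs `(M, N)` such that `M ⊑ N` holds in `G`. -/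
def orderTheory : Set (LambdaTerm × LambdaTerm) :=
  {p | ∀ ρ : ℕ → Set G.Web, G.interp p.1 ρ ⊆ G.interp p.2 ρ}

/-- The equational theory of `G`: all pairs `(M, N)` such that `M = N` holds in `G`. -/
def eqTheory : Set (LambdaTerm × LambdaTerm) :=
  {p | ∀ ρ : ℕ → Set G.Web, G.interp p.1 ρ = G.interp p.2 ρ}

end GraphModel

-- This is a downward Löwenheim–Skolem argument. Interpretation is monotone and continuous in the
-- environment (`exists_finEnv_mem_interp`), so each failing inequation fails at a point under a
-- finite environment. There are countably many pairs of terms, so countably many points witness all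
-- failures. Close these points under `code`, its partial inverse, and a choice of finite sets
-- witnessing membership in applications (`exists_countable_isElementary`). On the resulting
-- countable set, interpretation is the restriction of the original one
-- (`mem_interp_iff_of_embedding`), so inequations are preserved and, thanks to the witnesses,
-- reflected.

universe v

/-- An injective numbering of λ-terms. -/
def LambdaTerm.toNat : LambdaTerm → ℕ
  | .var x => Nat.pair 0 x
  | .app M N => Nat.pair 1 (Nat.pair M.toNat N.toNat)
  | .lam x M => Nat.pair 2 (Nat.pair x M.toNat)

theorem LambdaTerm.toNat_injective : Function.Injective LambdaTerm.toNat := by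
  intro M
  induction M with
  | var x => intro N h; cases N <;> simp_all [toNat, Nat.pair_eq_pair]
  | app M₁ M₂ ih₁ ih₂ =>
    intro N h
    cases N with
    | app N₁ N₂ =>
      simp only [toNat, Nat.pair_eq_pair, true_and] at h
      rw [ih₁ h.1, ih₂ h.2]
    | _ => simp [toNat, Nat.pair_eq_pair] at h
  | lam x M ih =>
    intro N h
    cases N with
    | lam y N =>
      simp only [toNat, Nat.pair_eq_pair, true_and] at h
      rw [h.1, ih h.2]
    | _ => simp [toNat, Nat.pair_eq_pair] at h

instance : Countable LambdaTerm := LambdaTerm.toNat_injective.countable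

/-- A countable set is contained in a countable set closed under a finitary operation with
countably many values on each argument. -/
theorem Set.Countable.exists_countable_closed {W : Type*} (Φ : Finset W → Set W)
    (hΦ : ∀ F, (Φ F).Countable) {C : Set W} (hC : C.Countable) :
    ∃ A : Set W, A.Countable ∧ C ⊆ A ∧ ∀ F : Finset W, (F : Set W) ⊆ A → Φ F ⊆ A := by
  let step : Set W → Set W := fun S => S ∪ ⋃ F ∈ {F : Finset W | (F : Set W) ⊆ S}, Φ F
  have hmono : Monotone fun n => step^[n] C := by
    refine monotone_nat_of_le_succ fun n => ?_
    rw [Function.iterate_succ_apply']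
    exact Set.subset_union_left
  have hcount : ∀ n, (step^[n] C).Countable := by
    intro n
    induction n with
    | zero => exact hC
    | succ n ih =>
      rw [Function.iterate_succ_apply']
      refine ih.union (Set.Countable.biUnion ?_ fun F _ => hΦ F)
      refine Set.Countable.mono (fun F hF => ?_) ((Set.countable_ofPred_finite_subset
        ih).preimage (f := fun F : Finset W => (F : Set W)) Finset.coe_injective)
      exact ⟨F.finite_toSet, hF⟩
  refine ⟨⋃ n, step^[n] C, Set.countable_iUnion hcount,
    Set.subset_iUnion (fun n => step^[n] C) 0, fun F hF => ?_⟩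
  -- The stages increase, so a finite subset of the union already lies in one stage.
  obtain ⟨n, hn⟩ := hmono.directed_le.exists_mem_subset_of_finset_subset_biUnion hF
  refine Set.Subset.trans ?_ (Set.subset_iUnion (fun n => step^[n] C) (n + 1))
  simp only [Function.iterate_succ_apply']
  exact Set.subset_union_of_subset_right (Set.subset_biUnion_of_mem (u := Φ) hn) _

/-! ### Monotonicity and continuity of the interpretation -/

namespace GraphModel

theorem interp_mono (G : GraphModel.{u}) (M : LambdaTerm) :
    Monotone (G.interp M) := by
  induction M with
  | var x => exact fun ρ σ h => h x
  | app M N ihM ihN =>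
    rintro ρ σ h α ⟨a, ha, hα⟩
    exact ⟨a, ha.trans (ihN h), ihM h hα⟩
  | lam x M ih =>
    rintro ρ σ h _ ⟨a, α, hα, rfl⟩
    exact ⟨a, α, ih (update_le_update_iff.2 ⟨le_rfl, fun y _ => h y⟩) hα, rfl⟩

/-- The environment with a finite graph. -/
def finEnv {W : Type*} (e : Finset (ℕ × W)) (n : ℕ) : Set W := {w | (n, w) ∈ e}

theorem finEnv_mono {W : Type*} {e e' : Finset (ℕ × W)} (h : e ⊆ e') : finEnv e ≤ finEnv e' :=
  fun _ _ hw => h hw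

theorem finEnv_union_le {W : Type*} [DecidableEq W] {e e' : Finset (ℕ × W)} {ρ : ℕ → Set W}
    (h : finEnv e ≤ ρ) (h' : finEnv e' ≤ ρ) : finEnv (e ∪ e') ≤ ρ :=
  fun n _ hw => (Finset.mem_union.1 hw).elim (fun k => h n k) (fun k => h' n k)

/-- The interpretation depends continuously on the environment. -/
theorem exists_finEnv_mem_interp (G : GraphModel.{u}) (M : LambdaTerm) :
    ∀ {ρ : ℕ → Set G.Web} {α : G.Web}, α ∈ G.interp M ρ →
      ∃ e, finEnv e ≤ ρ ∧ α ∈ G.interp M (finEnv e) := by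
  classical
  induction M with
  | var x =>
    intro ρ α h
    refine ⟨{(x, α)}, fun n w hw => ?_, Finset.mem_singleton_self _⟩
    obtain ⟨rfl, rfl⟩ := Prod.mk.inj (Finset.mem_singleton.1 hw)
    exact h
  | app M N ihM ihN =>
    rintro ρ α ⟨a, ha, hα⟩
    have key : ∀ b : Finset G.Web, (b : Set G.Web) ⊆ G.interp N ρ →
        ∃ e, finEnv e ≤ ρ ∧ (b : Set G.Web) ⊆ G.interp N (finEnv e) := by
      intro b
      induction b using Finset.induction_on with
      | empty => exact fun _ => ⟨∅, fun n w hw => by simp [finEnv] at hw, by simp⟩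
      | insert w b _ ih =>
        intro hb
        rw [Finset.coe_insert, Set.insert_subset_iff] at hb
        obtain ⟨e, he, hw⟩ := ihN hb.1
        obtain ⟨e', he', hb'⟩ := ih hb.2
        refine ⟨e ∪ e', finEnv_union_le he he', ?_⟩
        rw [Finset.coe_insert, Set.insert_subset_iff]
        exact ⟨G.interp_mono N (finEnv_mono Finset.subset_union_left) hw,
          hb'.trans (G.interp_mono N (finEnv_mono Finset.subset_union_right))⟩
    obtain ⟨e, he, hM⟩ := ihM hα
    obtain ⟨e', he', hN⟩ := key a ha
    exact ⟨e ∪ e', finEnv_union_le he he', a,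
      hN.trans (G.interp_mono N (finEnv_mono Finset.subset_union_right)),
      G.interp_mono M (finEnv_mono Finset.subset_union_left) hM⟩
  | lam x M ih =>
    rintro ρ _ ⟨a, α, hα, rfl⟩
    obtain ⟨e, he, hM⟩ := ih hα
    -- The pairs at the bound variable are dropped: its value comes from `a`, not from `ρ`.
    refine ⟨e.filter fun p => p.1 ≠ x, fun n w hw => ?_, a, α, G.interp_mono M ?_ hM, rfl⟩
    · obtain ⟨hw, hn⟩ := Finset.mem_filter.1 hw
      have := he n hw
      rwa [Function.update_of_ne hn] at this
    · intro n w hw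
      by_cases hn : n = x
      · subst hn
        have := he n hw
        rwa [Function.update_self] at this ⊢
      · rw [Function.update_of_ne hn]
        exact Finset.mem_filter.2 ⟨hw, hn⟩

/-! ### Countable elementary subsets of the web -/

/-- A set of points of the web of `G` on which `G` induces a graph model whose interpretation is
the restriction of that of `G`. -/
structure IsElementary (G : GraphModel.{u}) (A : Set G.Web) : Prop where
  code_mem : ∀ (a : Finset G.Web) (α : G.Web), (a : Set G.Web) ⊆ A → α ∈ A → G.code (a, α) ∈ A
  of_code_mem : ∀ (a : Finset G.Web) (α : G.Web), G.code (a, α) ∈ A →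
    (a : Set G.Web) ⊆ A ∧ α ∈ A
  app_mem : ∀ (M N : LambdaTerm) (e : Finset (ℕ × G.Web)) (α : G.Web), (∀ p ∈ e, p.2 ∈ A) →
    α ∈ A → α ∈ G.interp (.app M N) (finEnv e) →
    ∃ a : Finset G.Web, (a : Set G.Web) ⊆ A ∧ (a : Set G.Web) ⊆ G.interp N (finEnv e) ∧
      G.code (a, α) ∈ G.interp M (finEnv e)

/-- A Skolem hull: a finite set of points carries only countably many finite environments, and there
are countably many terms, so each finite set calls for countably many new points. -/
theorem exists_countable_isElementary (G : GraphModel.{u}) {C : Set G.Web} (hC : C.Countable) :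
    ∃ A : Set G.Web, A.Countable ∧ C ⊆ A ∧ G.IsElementary A := by
  classical
  have hwit : ∀ (M N : LambdaTerm) (e : Finset (ℕ × G.Web)) (α : G.Web),
      α ∈ G.interp (.app M N) (finEnv e) →
      ∃ a : Finset G.Web, (a : Set G.Web) ⊆ G.interp N (finEnv e) ∧
        G.code (a, α) ∈ G.interp M (finEnv e) := fun _ _ _ _ h => h
  choose! wit hwit using hwit
  -- Injectivity of `code` leaves at most one decomposition of `γ`, so a finite set suffices.
  have hparts : ∀ γ : G.Web, ∃ b : Finset G.Web, ∀ a α, G.code (a, α) = γ → insert α a ⊆ b := by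
    intro γ
    by_cases h : ∃ p, G.code p = γ
    · obtain ⟨p, rfl⟩ := h
      exact ⟨insert p.2 p.1, fun a α h => by rw [← G.code_injective h]⟩
    · exact ⟨∅, fun a α h' => (h ⟨_, h'⟩).elim⟩
  choose parts hparts using hparts
  let Φ : Finset G.Web → Set G.Web := fun F =>
    (⋃ a ∈ F.powerset, ⋃ α ∈ F, {G.code (a, α)}) ∪ (⋃ γ ∈ F, (parts γ : Set G.Web)) ∪
      ⋃ (M : LambdaTerm) (N : LambdaTerm) (e : Finset (ℕ × F)) (α : F),
        (wit M N (e.image (Prod.map id Subtype.val)) α : Set G.Web)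
  have hΦ : ∀ F, (Φ F).Countable := by
    intro F
    refine Set.Countable.union (Set.Countable.union ?_ ?_) ?_
    · exact (Finset.countable_toSet _).biUnion fun a _ => (Finset.countable_toSet _).biUnion
        fun α _ => Set.countable_singleton _
    · exact (Finset.countable_toSet _).biUnion fun a _ => Finset.countable_toSet _
    · exact Set.countable_iUnion fun M => Set.countable_iUnion fun N => Set.countable_iUnion
        fun e => Set.countable_iUnion fun α => Finset.countable_toSet _
  obtain ⟨A, hA, hCA, hcl⟩ := hC.exists_countable_closed Φ hΦ
  refine ⟨A, hA, hCA, fun a α ha hα => ?_, fun a α h => ?_, fun M N e α he hα h => ?_⟩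
  · refine hcl (insert α a) (by simp [Set.insert_subset_iff, ha, hα]) (.inl (.inl ?_))
    simp only [Set.mem_iUnion]
    exact ⟨a, Finset.mem_powerset.2 (Finset.subset_insert _ _), α, Finset.mem_insert_self _ _, rfl⟩
  · have hsub : ((insert α a : Finset G.Web) : Set G.Web) ⊆ A := by
      refine Set.Subset.trans (fun x hx => .inl (.inr ?_)) (hcl {G.code (a, α)} (by simpa using h))
      simp only [Set.mem_iUnion]
      exact ⟨_, Finset.mem_singleton_self _, hparts _ a α rfl hx⟩
    rw [Finset.coe_insert, Set.insert_subset_iff] at hsub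
    exact hsub.symm
  · refine ⟨wit M N e α, ?_, hwit M N e α h⟩
    let F := insert α (e.image Prod.snd)
    have hF : (F : Set G.Web) ⊆ A := by
      intro x hx
      rcases Finset.mem_insert.1 hx with rfl | hx
      · exact hα
      · obtain ⟨p, hp, rfl⟩ := Finset.mem_image.1 hx
        exact he p hp
    refine Set.Subset.trans (fun x hx => .inr ?_) (hcl F hF)
    simp only [Set.mem_iUnion]
    refine ⟨M, N, e.attach.image fun p => (p.1.1, ⟨p.1.2, Finset.mem_insert_of_mem
      (Finset.mem_image_of_mem _ p.2)⟩), ⟨α, Finset.mem_insert_self _ _⟩, ?_⟩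
    convert hx
    ext ⟨n, w⟩
    simp only [Finset.mem_image, Finset.mem_attach, true_and, Subtype.exists, Prod.exists]
    constructor
    · rintro ⟨_, _, _, ⟨n, w, hw, h⟩, h'⟩
      cases h
      cases h'
      exact hw
    · exact fun hw => ⟨n, w, Finset.mem_insert_of_mem (Finset.mem_image_of_mem _ hw),
        ⟨n, w, hw, rfl⟩, rfl⟩

/-- Along an embedding of webs with elementary range, interpretation is given by restriction. -/
theorem mem_interp_iff_of_embedding {G : GraphModel.{u}} {G' : GraphModel.{v}}
    (f : G'.Web ↪ G.Web) (hf : ∀ a α, f (G'.code (a, α)) = G.code (a.map f, f α))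
    (hA : G.IsElementary (Set.range f)) (M : LambdaTerm) :
    ∀ (ρ : ℕ → Set G'.Web) (α : G'.Web),
      α ∈ G'.interp M ρ ↔ f α ∈ G.interp M fun n => f '' ρ n := by
  classical
  have hlift : ∀ a : Finset G.Web, (a : Set G.Web) ⊆ Set.range f →
      ∃ b : Finset G'.Web, b.map f = a := by
    intro a ha
    refine ⟨a.preimage f f.injective.injOn, ?_⟩
    rw [Finset.map_eq_image, Finset.image_preimage_of_bij]
    exact ⟨fun x hx => hx, f.injective.injOn, fun x hx => by
      obtain ⟨y, rfl⟩ := ha hx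
      exact ⟨y, hx, rfl⟩⟩
  induction M with
  | var x => exact fun ρ α => (f.injective.mem_set_image).symm
  | app M N ihM ihN =>
    intro ρ α
    constructor
    · rintro ⟨a, ha, hα⟩
      refine ⟨a.map f, ?_, ?_⟩
      · intro x hx
        obtain ⟨y, hy, rfl⟩ := Finset.mem_map.1 hx
        exact (ihN ρ y).1 (ha hy)
      · rw [← hf]
        exact (ihM ρ _).1 hα
    · intro h
      -- Witnesses in the range are available only for finite environments; continuity passes to one
      -- and monotonicity returns to `ρ`.
      obtain ⟨e, he, h⟩ := G.exists_finEnv_mem_interp (.app M N) h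
      obtain ⟨a, haA, haN, haM⟩ := hA.app_mem M N e (f α)
        (fun p hp => Set.image_subset_range _ _ (he p.1 hp)) ⟨α, rfl⟩ h
      obtain ⟨b, rfl⟩ := hlift a haA
      refine ⟨b, fun y hy => (ihN ρ y).2 (G.interp_mono N he ?_), (ihM ρ _).2 ?_⟩
      · exact haN (Finset.mem_map_of_mem f hy)
      · rw [hf]
        exact G.interp_mono M he haM
  | lam x M ih =>
    intro ρ γ
    have hupd : ∀ b : Finset G'.Web, (fun n => f '' Function.update ρ x (b : Set G'.Web) n) =
        Function.update (fun n => f '' ρ n) x ((b.map f : Finset G.Web) : Set G.Web) := by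
      intro b
      funext n
      by_cases hn : n = x
      · subst hn; simp
      · simp [hn]
    constructor
    · rintro ⟨a, α, hα, rfl⟩
      refine ⟨a.map f, f α, ?_, hf a α⟩
      beta_reduce
      rw [← hupd]
      exact (ih _ α).1 hα
    · rintro ⟨a, α, hα, hγ⟩
      obtain ⟨haA, α, rfl⟩ := hA.of_code_mem a α ⟨γ, hγ⟩
      obtain ⟨b, rfl⟩ := hlift a haA
      refine ⟨b, α, (ih _ α).2 ?_, f.injective (by rw [hγ, hf])⟩
      rw [hupd]
      exact hα

/-- An elementary set is, up to size, the web of a graph model. -/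
theorem IsElementary.exists_graphModel {G : GraphModel.{u}} {A : Set G.Web}
    (hA : G.IsElementary A) (hne : A.Nonempty) [Small.{v} A] :
    ∃ (G' : GraphModel.{v}) (f : G'.Web ↪ G.Web), Set.range f = A ∧
      ∀ a α, f (G'.code (a, α)) = G.code (a.map f, f α) := by
  let φ := (equivShrink.{v} A).symm
  let f : Shrink.{v} A ↪ G.Web := φ.toEmbedding.trans (Function.Embedding.subtype _)
  have hfA : ∀ w, f w ∈ A := fun w => (φ w).2
  have hmem : ∀ p : Finset (Shrink.{v} A) × Shrink.{v} A, G.code (p.1.map f, f p.2) ∈ A := by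
    refine fun p => hA.code_mem _ _ (fun x hx => ?_) (hfA _)
    obtain ⟨y, _, rfl⟩ := Finset.mem_map.1 hx
    exact hfA y
  refine ⟨⟨Shrink.{v} A, ⟨φ.symm ⟨_, hne.some_mem⟩⟩, fun p => φ.symm ⟨_, hmem p⟩, fun p q h => ?_⟩, f,
    ?_, fun a α => ?_⟩
  · have h := Prod.mk.inj (G.code_injective (Subtype.mk.inj (φ.symm.injective h)))
    exact Prod.ext (Finset.map_injective f h.1) (f.injective h.2)
  · ext x
    exact ⟨by rintro ⟨w, rfl⟩; exact hfA w, fun hx => ⟨φ.symm ⟨x, hx⟩, by simp [f]⟩⟩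
  · simp [f]

theorem eqTheory_eq_of_orderTheory_eq {G : GraphModel.{u}} {G' : GraphModel.{v}}
    (h : G'.orderTheory = G.orderTheory) : G'.eqTheory = G.eqTheory := by
  have key : ∀ p : LambdaTerm × LambdaTerm, (p ∈ G'.orderTheory ∧ p.swap ∈ G'.orderTheory) ↔
      (p ∈ G.orderTheory ∧ p.swap ∈ G.orderTheory) := fun p => by rw [h]
  ext p
  simpa only [orderTheory, eqTheory, Set.mem_ofPred_eq, Prod.fst_swap, Prod.snd_swap,
    ← forall_and, ← Set.Subset.antisymm_iff] using key p

/-- Failures of inequations in `G` are all witnessed within a countable set of points. -/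
theorem exists_countable_separating (G : GraphModel.{u}) :
    ∃ C : Set G.Web, C.Countable ∧ C.Nonempty ∧ ∀ p ∉ G.orderTheory,
      ∃ (e : Finset (ℕ × G.Web)) (α : G.Web), (∀ q ∈ e, q.2 ∈ C) ∧ α ∈ C ∧
        α ∈ G.interp p.1 (finEnv e) ∧ α ∉ G.interp p.2 (finEnv e) := by
  classical
  have : Nonempty G.Web := G.nonempty
  have hsep : ∀ p : LambdaTerm × LambdaTerm, p ∉ G.orderTheory →
      ∃ (e : Finset (ℕ × G.Web)) (α : G.Web),
        α ∈ G.interp p.1 (finEnv e) ∧ α ∉ G.interp p.2 (finEnv e) := by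
    intro p hp
    simp only [orderTheory, Set.mem_ofPred_eq, not_forall, Set.not_subset] at hp
    obtain ⟨ρ, α, hα, hα'⟩ := hp
    obtain ⟨e, he, h⟩ := G.exists_finEnv_mem_interp p.1 hα
    exact ⟨e, α, h, fun h' => hα' (G.interp_mono p.2 he h')⟩
  choose! e α hsep using hsep
  refine ⟨⋃ p, ((insert (α p) ((e p).image Prod.snd) : Finset G.Web) : Set G.Web),
    Set.countable_iUnion fun p => Finset.countable_toSet _, ?_, fun p hp => ⟨e p, α p,
    fun q hq => ?_, ?_, hsep p hp⟩⟩
  -- Any pair would do: pairs in the order theory also contribute a point, with an arbitrary value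
  -- of `α`.
  · exact ⟨α (.var 0, .var 0), Set.mem_iUnion.2 ⟨_, Finset.mem_insert_self _ _⟩⟩
  · exact Set.mem_iUnion.2 ⟨p, Finset.mem_insert_of_mem (Finset.mem_image_of_mem _ hq)⟩
  · exact Set.mem_iUnion.2 ⟨p, Finset.mem_insert_self _ _⟩

end GraphModel

theorem mainTheorem12 (G : GraphModel.{u}) :
    ∃ G' : GraphModel.{0}, Countable G'.Web ∧
      G'.orderTheory = G.orderTheory ∧ G'.eqTheory = G.eqTheory := by
  obtain ⟨C, hC, hne, hsep⟩ := G.exists_countable_separating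
  obtain ⟨A, hAc, hCA, hA⟩ := G.exists_countable_isElementary hC
  have : Countable A := hAc
  obtain ⟨G', f, rfl, hf⟩ := hA.exists_graphModel.{u, 0} (hne.mono hCA)
  have hinterp := GraphModel.mem_interp_iff_of_embedding f hf hA
  have horder : G'.orderTheory = G.orderTheory := by
    ext p
    refine ⟨fun hp => ?_, fun hp ρ α hα => ?_⟩
    · by_contra hp'
      obtain ⟨e, α, he, hα, h, h'⟩ := hsep p hp'
      obtain ⟨α, rfl⟩ := hCA hα
      -- The separating environment takes values in the range of `f`, so pulling it back loses
      -- nothing.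
      have henv : (fun n => f '' (f ⁻¹' GraphModel.finEnv e n)) = GraphModel.finEnv e := by
        funext n
        exact Set.image_preimage_eq_of_subset fun w hw => hCA (he _ hw)
      have := (hinterp p.2 (fun n => f ⁻¹' GraphModel.finEnv e n) α).1
        (hp _ ((hinterp p.1 _ α).2 (by rwa [henv])))
      rw [henv] at this
      exact h' this
    · exact (hinterp p.2 ρ α).2 (hp _ ((hinterp p.1 ρ α).1 hα))
  have : Countable G'.Web := (Equiv.ofInjective f f.injective).injective.countable
  exact ⟨G', this, horder, GraphModel.eqTheory_eq_of_orderTheory_eq horder⟩
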